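/- All graphs are finite and undirected. For loopless graphs $G$ and $H$, let $\mathrm{Hom}(G,H)$ be the polyhedral complex whose cells are indexed by the functions $\eta: V(G)\to 2^{V(H)}\setminus\{\emptyset\}$ such that, whenever $x,y$ are adjacent in $G$, every $a\in\eta(x)$ is adjacent in $H$ to every $b\in\eta(y)$. The closed cell of $\eta$ is the product $\prod_{x\in V(G)}\Delta^{\eta(x)}$ of the simplices with vertex sets $\eta(x)$, regarded as a subset of $\prod_{x\in V(G)}\Delta^{V(H)}$, and the underlying space of $\mathrm{Hom}(G,H)$ is the union of these closed cells, with the subspace topology. A graph homomorphism $\varphi: G\to G'$ induces the continuous map $\varphi_H:\mathrm{Hom}(G',H)\to\mathrm{Hom}(G,H)$, $(p_{y})_{y\in V(G')}\mapsto (p_{\varphi(x)})_{x\in V(G)}$. Let $K_n$ be the complete loopless graph on $n$ vertices, $n\ge 0$, and let $\overline{F}$ be the loopless complement of a graph $F$ (distinct vertices are adjacent in $\overline F$ exactly when they are not adjacent in $F$). **Corollary.** Let $n\ge 0$. 1. If $T$ is a tree with at least one edge, then for every inclusion (injective graph homomorphism) $i: K_2\hookrightarrow T$ the induced map $i_{K_n}:\mathrm{Hom}(T,K_n)\to\mathrm{Hom}(K_2,K_n)$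 is a homotopy equivalence. 2. If $F$ is a forest, then $\mathrm{Hom}(\overline{F},K_n)$ is homotopy equivalent to $\mathrm{Hom}(K_m,K_n)$, where $m$ is the maximal cardinality of an independent set in $F$. -/

import Mathlib

/-- `η`, a function assigning to each vertex of `G` a nonempty set of vertices of `H`, indexes a
cell of `Hom(G, H)`: whenever `x, y` are adjacent in `G`, every element of `η x` is adjacent
in `H` to every element of `η y`. -/
def IsHomCell {V W : Type*} (G : SimpleGraph V) (H : SimpleGraph W) (η : V → Set W) : Prop :=
  (∀ x, (η x).Nonempty) ∧ ∀ x y, G.Adj x y → ∀ a ∈ η x, ∀ b ∈ η y, H.Adj a b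

/-- The closed polyhedral cell indexed by `η`: the product over the vertices `x` of the simplices
spanned by `η x`, inside the product of copies of the full simplex on the vertex set `W`. -/
def closedHomCell {V W : Type*} [Fintype W] (η : V → Set W) : Set (V → W → ℝ) :=
  {p | ∀ x, p x ∈ stdSimplex ℝ W ∧ Function.support (p x) ⊆ η x}

/-- The underlying space of the polyhedral complex `Hom(G, H)` (for finite graphs `G`, `H`): the
union of its closed cells, with the subspace topology of the Euclidean space `ℝ^(V × W)`. -/
def HomComplex {V W : Type*} [Fintype W] (G : SimpleGraph V) (H : SimpleGraph W) :
    Set (V → W → ℝ) :=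
  {p | ∃ η : V → Set W, IsHomCell G H η ∧ p ∈ closedHomCell η}

theorem HomComplex.comp_mem {V V' W : Type*} [Fintype W] {G : SimpleGraph V}
    {G' : SimpleGraph V'} {H : SimpleGraph W} (φ : G →g G') {p : V' → W → ℝ}
    (hp : p ∈ HomComplex G' H) : (fun x => p (φ x)) ∈ HomComplex G H := by
  obtain ⟨η, ⟨hne, hadj⟩, hη⟩ := hp
  exact ⟨fun x => η (φ x),
    ⟨fun x => hne (φ x), fun x y hxy => hadj (φ x) (φ y) (φ.map_adj hxy)⟩, fun x => hη (φ x)⟩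

/-- The map `φ_H : Hom(G', H) → Hom(G, H)` induced by a graph homomorphism `φ : G → G'`; it sends
the cell `η` into the cell `η ∘ φ`, and is the coordinate map `p ↦ p ∘ φ` on points. -/
def homComplexMap {V V' W : Type*} [Fintype W] {G : SimpleGraph V} {G' : SimpleGraph V'}
    (φ : G →g G') (H : SimpleGraph W) : C(HomComplex G' H, HomComplex G H) where
  toFun p := ⟨fun x => p.1 (φ x), HomComplex.comp_mem φ p.2⟩
  continuous_toFun := by
    refine Continuous.subtype_mk (continuous_pi fun x => ?_) _
    exact (continuous_apply (φ x)).comp continuous_subtype_val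

/-- The continuous map `f` is a homotopy equivalence. -/
def IsHomotopyEquivalence {X Y : Type*} [TopologicalSpace X] [TopologicalSpace Y]
    (f : C(X, Y)) : Prop :=
  ∃ g : C(Y, X), (g.comp f).Homotopic (ContinuousMap.id X) ∧
    (f.comp g).Homotopic (ContinuousMap.id Y)

/-! Everything rests on folding: if every neighbor of `v` is a neighbor of `u ≠ v`, then deleting
`v` does not change the homotopy type of `Hom(G, H)`, for any `H`
(`isHomotopyEquivalence_induce_compl_singleton`). A tree folds down to any prescribed edge, one leaf
at a time. The complement of a forest folds down to a complete graph; folds preserve the clique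
number, so its order is the independence number of the forest. -/

/-- The supports of the `p x` index the smallest cell containing `p`, so cells can be dispensed
with. -/
theorem HomComplex.mem_iff {V W : Type*} [Fintype W] {G : SimpleGraph V} {H : SimpleGraph W}
    {p : V → W → ℝ} : p ∈ HomComplex G H ↔ (∀ x, p x ∈ stdSimplex ℝ W) ∧
      ∀ x y, G.Adj x y → ∀ a b, p x a ≠ 0 → p y b ≠ 0 → H.Adj a b := by
  constructor
  · rintro ⟨η, ⟨-, hadj⟩, hη⟩
    exact ⟨fun x => (hη x).1, fun x y hxy a b ha hb =>
      hadj x y hxy a ((hη x).2 ha) b ((hη y).2 hb)⟩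
  · rintro ⟨hp, hadj⟩
    refine ⟨fun x => Function.support (p x), ⟨fun x => ?_, fun x y hxy a ha b hb =>
      hadj x y hxy a b ha hb⟩, fun x => ⟨hp x, subset_rfl⟩⟩
    by_contra hne
    have h0 : p x = 0 := by
      rwa [Set.not_nonempty_iff_eq_empty, Function.support_eq_empty_iff] at hne
    simpa [h0] using (hp x).2

/-- If adjacent vertices are sent to adjacent vertices by `φ` and `ψ` respectively, then the maps
induced by `φ` and `ψ` are homotopic, through the straight line homotopy. -/
theorem homComplexMap_homotopic {V V' W : Type*} [Fintype W] {G : SimpleGraph V}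
    {G' : SimpleGraph V'} (φ ψ : G →g G') (h : ∀ x y, G.Adj x y → G'.Adj (φ x) (ψ y))
    (H : SimpleGraph W) : (homComplexMap φ H).Homotopic (homComplexMap ψ H) := by
  refine ⟨⟨⟨fun q => ⟨fun x => (1 - (q.1 : ℝ)) • q.2.1 (φ x) + (q.1 : ℝ) • q.2.1 (ψ x), ?_⟩, ?_⟩,
    fun p => ?_, fun p => ?_⟩⟩
  · obtain ⟨t, p, hp⟩ := q
    rw [HomComplex.mem_iff] at hp ⊢
    obtain ⟨hp, hadj⟩ := hp
    refine ⟨fun x => convex_stdSimplex ℝ W (hp _) (hp _) (sub_nonneg.2 t.2.2) t.2.1 (by ring), ?_⟩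
    intro x y hxy a b ha hb
    have key : ∀ {z c}, ((1 - (t : ℝ)) • p (φ z) + (t : ℝ) • p (ψ z)) c ≠ 0 →
        p (φ z) c ≠ 0 ∨ p (ψ z) c ≠ 0 := by
      intro z c hc
      by_contra! h0
      exact hc (by simp [h0.1, h0.2])
    -- The mixed cases, one label from `φ` and one from `ψ`, are what `h` is for.
    rcases key ha with ha | ha <;> rcases key hb with hb | hb
    · exact hadj _ _ (φ.map_adj hxy) a b ha hb
    · exact hadj _ _ (h x y hxy) a b ha hb
    · exact hadj _ _ (h y x hxy.symm).symm a b ha hb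
    · exact hadj _ _ (ψ.map_adj hxy) a b ha hb
  · refine Continuous.subtype_mk (continuous_pi fun x => ?_) _
    have hc : ∀ z : V', Continuous fun q : unitInterval × HomComplex G' H => q.2.1 z := fun z =>
      (continuous_apply z).comp (continuous_subtype_val.comp continuous_snd)
    have ht : Continuous fun q : unitInterval × HomComplex G' H => (q.1 : ℝ) :=
      continuous_subtype_val.comp continuous_fst
    exact ((continuous_const.sub ht).smul (hc _)).add (ht.smul (hc _))
  · ext x a
    simp [homComplexMap]
  · ext x a
    simp [homComplexMap]

theorem IsHomotopyEquivalence.comp {X Y Z : Type*} [TopologicalSpace X] [TopologicalSpace Y]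
    [TopologicalSpace Z] {g : C(Y, Z)} {f : C(X, Y)} (hg : IsHomotopyEquivalence g)
    (hf : IsHomotopyEquivalence f) : IsHomotopyEquivalence (g.comp f) := by
  obtain ⟨f', hf₁, hf₂⟩ := hf
  obtain ⟨g', hg₁, hg₂⟩ := hg
  let e : ContinuousMap.HomotopyEquiv X Y := ⟨f, f', hf₁, hf₂⟩
  let e' : ContinuousMap.HomotopyEquiv Y Z := ⟨g, g', hg₁, hg₂⟩
  exact ⟨_, (e.trans e').left_inv, (e.trans e').right_inv⟩

theorem IsHomotopyEquivalence.nonempty_homotopyEquiv {X Y : Type*} [TopologicalSpace X]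
    [TopologicalSpace Y] {f : C(X, Y)} (hf : IsHomotopyEquivalence f) :
    Nonempty (ContinuousMap.HomotopyEquiv X Y) :=
  let ⟨g, h₁, h₂⟩ := hf
  ⟨⟨f, g, h₁, h₂⟩⟩

theorem isHomotopyEquivalence_homComplexMap {V V' W : Type*} [Fintype W] {G : SimpleGraph V}
    {G' : SimpleGraph V'} (φ : G →g G') (ψ : G' →g G)
    (h : ∀ x y, G.Adj x y → G.Adj (ψ (φ x)) y) (h' : ∀ x y, G'.Adj x y → G'.Adj (φ (ψ x)) y)
    (H : SimpleGraph W) : IsHomotopyEquivalence (homComplexMap φ H) :=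
  ⟨homComplexMap ψ H, homComplexMap_homotopic (φ.comp ψ) SimpleGraph.Hom.id h' H,
    homComplexMap_homotopic (ψ.comp φ) SimpleGraph.Hom.id h H⟩

namespace SimpleGraph

/-- The folding map `G → G - v` sending `v` to `u`, where every neighbor of `v` is one of `u`. -/
noncomputable def foldHom {V : Type*} (G : SimpleGraph V) {u v : V} (huv : u ≠ v)
    (h : ∀ y, G.Adj v y → G.Adj u y) : G →g G.induce {v}ᶜ := by
  classical
  exact
    { toFun := fun x => if hx : x = v then ⟨u, huv⟩ else ⟨x, hx⟩
      map_rel' := by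
        intro x y hxy
        by_cases hx : x = v <;> by_cases hy : y = v
        · exact absurd hxy (by simp [hx, hy])
        · simpa [hx, hy] using h y (hx ▸ hxy)
        · simpa [hx, hy] using (h x (hy ▸ hxy.symm)).symm
        · simpa [hx, hy] using hxy }

theorem foldHom_coe_of_ne {V : Type*} {G : SimpleGraph V} {u v : V} (huv : u ≠ v)
    (h : ∀ y, G.Adj v y → G.Adj u y) {x : V} (hx : x ≠ v) : (G.foldHom huv h x : V) = x := by
  simp [foldHom, hx]

theorem foldHom_coe_self {V : Type*} {G : SimpleGraph V} {u v : V} (huv : u ≠ v)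
    (h : ∀ y, G.Adj v y → G.Adj u y) : (G.foldHom huv h v : V) = u := by
  simp [foldHom]

theorem isHomotopyEquivalence_induce_compl_singleton {V W : Type*} [Fintype W]
    (G : SimpleGraph V) {u v : V} (huv : u ≠ v) (h : ∀ y, G.Adj v y → G.Adj u y)
    (H : SimpleGraph W) :
    IsHomotopyEquivalence (homComplexMap (Embedding.induce (G := G) {v}ᶜ).toHom H) := by
  refine isHomotopyEquivalence_homComplexMap _ (G.foldHom huv h) ?_ ?_ H
  · intro x y hxy
    change G.Adj (G.foldHom huv h x : V) y
    rw [foldHom_coe_of_ne huv h x.2]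
    exact hxy
  · intro x y hxy
    change G.Adj (G.foldHom huv h x : V) y
    by_cases hx : x = v
    · subst hx
      rw [foldHom_coe_self]
      exact h y hxy
    · rwa [foldHom_coe_of_ne huv h hx]

/-- The target has no loops, so a homomorphism is injective on cliques. -/
theorem Hom.cliqueNum_le {V V' : Type*} [Finite V'] {G : SimpleGraph V} [Finite V]
    {G' : SimpleGraph V'} (φ : G →g G') : G.cliqueNum ≤ G'.cliqueNum := by
  classical
  obtain ⟨s, hs⟩ := G.exists_isNClique_cliqueNum
  have hinj : Set.InjOn φ s := fun x hx y hy hxy => by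
    by_contra hne
    exact (φ.map_adj (hs.isClique hx hy hne)).ne hxy
  have hcl : G'.IsClique (s.image φ : Finset V') := by
    intro a ha b hb hab
    simp only [Finset.coe_image, Set.mem_image] at ha hb
    obtain ⟨x, hx, rfl⟩ := ha
    obtain ⟨y, hy, rfl⟩ := hb
    exact φ.map_adj (hs.isClique hx hy fun e => hab (e ▸ rfl))
  have := hcl.card_le_cliqueNum
  rwa [Finset.card_image_of_injOn hinj, hs.card_eq] at this

theorem compl_induce {V : Type*} (F : SimpleGraph V) (s : Set V) :
    (F.induce s)ᶜ = Fᶜ.induce s := by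
  ext x y
  simp [Subtype.ext_iff]

/-- An end of a longest path works: a further neighbor would extend the path or close a cycle. -/
theorem IsAcyclic.exists_leaf {V : Type*} [Finite V] {F : SimpleGraph V} (hF : F.IsAcyclic)
    (hne : F ≠ ⊥) : ∃ u v, F.Adj u v ∧ ∀ y, F.Adj u y → y = v := by
  have : Nonempty V := by
    by_contra h
    rw [not_nonempty_iff] at h
    exact hne (Subsingleton.elim _ _)
  obtain ⟨u, v, p, hp, hmax⟩ := Walk.exists_isPath_forall_isPath_length_le_length F
  obtain ⟨a, b, hab⟩ := ne_bot_iff_exists_adj.mp hne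
  have hnil : ¬p.Nil := by
    intro h
    have h₁ := hmax a b (Path.singleton hab).1 (Path.singleton hab).2
    rw [Walk.length_eq_zero_iff.mpr h] at h₁
    simp [Path.singleton] at h₁
  refine ⟨u, p.snd, p.adj_snd hnil, fun w hadj => ?_⟩
  apply hF.eq_snd_of_adj_start hp hadj
  have : ¬(p.cons hadj.symm).IsPath := by grind [Walk.length_cons]
  grind [hp.cons]

theorem IsAcyclic.nonempty_homotopyEquiv_compl {W : Type*} [Fintype W] (H : SimpleGraph W)
    {V : Type*} [Finite V] (F : SimpleGraph V) (hF : F.IsAcyclic) :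
    Nonempty (ContinuousMap.HomotopyEquiv (HomComplex Fᶜ H)
      (HomComplex (completeGraph (Fin F.indepNum)) H)) := by
  induction hn : Nat.card V using Nat.strong_induction_on generalizing V with
  | _ n ih =>
  by_cases hbot : F = ⊥
  · subst hbot
    have := Fintype.ofFinite V
    have hcard : Fintype.card (Fin (⊥ : SimpleGraph V).indepNum) = Fintype.card V := by
      rw [Fintype.card_fin]
      refine le_antisymm ?_ ?_
      · obtain ⟨s, hs⟩ := (⊥ : SimpleGraph V).exists_isNIndepSet_indepNum
        rw [← hs.card_eq]
        exact s.card_le_univ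
      · exact IsIndepSet.card_le_indepNum (t := Finset.univ) fun x _ y _ _ => by simp
    let e := Fintype.equivOfCardEq hcard
    refine (isHomotopyEquivalence_homComplexMap (G := completeGraph (Fin _))
      ⟨e, fun {x y} hxy => ?_⟩ ⟨e.symm, fun {x y} hxy => ?_⟩ ?_ ?_ H).nonempty_homotopyEquiv
    · simpa using hxy.ne
    · simpa using hxy.ne
    · intro x y hxy
      simpa using hxy
    · intro x y hxy
      simpa using hxy
  · obtain ⟨u, v, huv, hu⟩ := hF.exists_leaf hbot
    -- The leaf `u` stays and its neighbor `v` goes: in `Fᶜ`, `u` is adjacent to every vertex other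
    -- than `u` and `v`.
    have hfold : ∀ y, Fᶜ.Adj v y → Fᶜ.Adj u y := by
      intro y hy
      rw [compl_adj] at hy ⊢
      exact ⟨fun e => hy.2 (e ▸ huv.symm), fun e => hy.1 (hu y e).symm⟩
    have hindep : (F.induce {v}ᶜ).indepNum = F.indepNum := by
      rw [← cliqueNum_compl, ← cliqueNum_compl, compl_induce]
      exact le_antisymm (Embedding.induce (G := Fᶜ) {v}ᶜ).toHom.cliqueNum_le
        (Fᶜ.foldHom huv.ne hfold).cliqueNum_le
    have hlt : Nat.card ({v}ᶜ : Set V) < n := by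
      rw [← hn]
      exact Finite.card_subtype_lt (x := v) (by simp)
    obtain ⟨e⟩ := ih _ hlt (F.induce {v}ᶜ) (hF.induce _) rfl
    obtain ⟨e'⟩ := (isHomotopyEquivalence_induce_compl_singleton Fᶜ huv.ne hfold
      H).nonempty_homotopyEquiv
    rw [hindep, compl_induce] at e
    exact ⟨e'.trans e⟩

/-- The leaf must avoid the given edge so that `i` factors through the smaller tree. -/
theorem IsTree.exists_leaf_notMem_range {V : Type*} [Finite V] {T : SimpleGraph V}
    (hT : T.IsTree) (i : completeGraph (Fin 2) →g T) (hi : ¬Function.Surjective i) :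
    ∃ v w, v ∉ Set.range i ∧ (T.induce {v}ᶜ).IsTree ∧ T.Adj v w ∧ ∀ y, T.Adj v y → y = w := by
  classical
  have := Fintype.ofFinite V
  have h01 : T.Adj (i 0) (i 1) := i.map_adj (by simp)
  have : Nontrivial V := ⟨_, _, h01.ne⟩
  obtain ⟨a, b, hab, ha, hb⟩ := hT.exists_ne_and_degree_eq_one
  have htree : ∀ {v}, T.degree v = 1 → (T.induce {v}ᶜ).IsTree := fun hv =>
    ⟨hT.connected.induce_compl_singleton_of_degree_eq_one hv, hT.isAcyclic.induce _⟩
  -- Otherwise the leaves `a`, `b` are adjacent, and deleting `a` isolates `b` in a tree that still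
  -- contains a third vertex `z`.
  have hmain : a ∉ Set.range i ∨ b ∉ Set.range i := by
    by_contra! hmem
    have hadj : T.Adj a b := by
      obtain ⟨⟨x, rfl⟩, y, rfl⟩ := hmem
      exact i.map_adj fun e => hab (e ▸ rfl)
    obtain ⟨z, hz⟩ := not_forall.mp hi
    have hza : z ≠ a := fun e => hz (e ▸ hmem.1)
    have hzb : z ≠ b := fun e => hz (e ▸ hmem.2)
    have : Nontrivial ({a}ᶜ : Set V) :=
      ⟨⟨z, hza⟩, ⟨b, hab.symm⟩, fun e => hzb (Subtype.ext_iff.mp e)⟩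
    obtain ⟨c, hc⟩ := (htree ha).connected.preconnected.exists_adj_of_nontrivial ⟨b, hab.symm⟩
    exact c.2 ((degree_eq_one_iff_existsUnique_adj.mp hb).unique hc hadj.symm)
  rcases hmain with h | h
  · obtain ⟨w, hw, hw'⟩ := degree_eq_one_iff_existsUnique_adj.mp ha
    exact ⟨a, w, h, htree ha, hw, hw'⟩
  · obtain ⟨w, hw, hw'⟩ := degree_eq_one_iff_existsUnique_adj.mp hb
    exact ⟨b, w, h, htree hb, hw, hw'⟩

theorem IsTree.isHomotopyEquivalence_homComplexMap {W : Type*} [Fintype W] (H : SimpleGraph W)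
    {V : Type*} [Finite V] (T : SimpleGraph V) (hT : T.IsTree)
    (i : completeGraph (Fin 2) →g T) (hi : Function.Injective i) :
    IsHomotopyEquivalence (homComplexMap i H) := by
  induction hn : Nat.card V using Nat.strong_induction_on generalizing V with
  | _ n ih =>
  by_cases hsurj : Function.Surjective i
  · let e := Equiv.ofBijective i ⟨hi, hsurj⟩
    have he : ∀ x, i (e.symm x) = x := fun x => e.apply_symm_apply x
    have he' : ∀ x, e.symm (i x) = x := fun x => e.symm_apply_apply x
    refine _root_.isHomotopyEquivalence_homComplexMap i
      ⟨e.symm, fun {x y} hxy => e.symm.injective.ne hxy.ne⟩ ?_ ?_ H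
    · intro x y hxy
      change (completeGraph (Fin 2)).Adj (e.symm (i x)) y
      rwa [he']
    · intro x y hxy
      change T.Adj (i (e.symm x)) y
      rwa [he]
  · obtain ⟨v, w, hv, hT', hvw, hw⟩ := hT.exists_leaf_notMem_range i hsurj
    have hiv : ∀ x, i x ≠ v := fun x e => hv ⟨x, e⟩
    have : Nontrivial ({v}ᶜ : Set V) :=
      ⟨⟨i 0, hiv 0⟩, ⟨i 1, hiv 1⟩, fun e => by simpa using hi (Subtype.ext_iff.mp e)⟩
    -- The leaf `v` folds onto another neighbor `u` of its only neighbor `w`.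
    obtain ⟨u, hu⟩ := hT'.connected.preconnected.exists_adj_of_nontrivial ⟨w, hvw.ne'⟩
    have hfold : ∀ y, T.Adj v y → T.Adj u y := fun y hy => by
      rw [hw y hy]
      exact hu.symm
    have hlt : Nat.card ({v}ᶜ : Set V) < n := by
      rw [← hn]
      exact Finite.card_subtype_lt (x := v) (by simp)
    exact (ih _ hlt (T.induce {v}ᶜ) hT' ⟨fun x => ⟨i x, hiv x⟩, fun hxy => i.map_adj hxy⟩
      (fun x y hxy => hi (Subtype.ext_iff.mp hxy)) rfl).comp
      (isHomotopyEquivalence_induce_compl_singleton T u.2 hfold H)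

end SimpleGraph

theorem mainTheorem9 (n : ℕ) :
    (∀ (V : Type*) [Finite V] (T : SimpleGraph V), T.IsTree → T.edgeSet.Nonempty →
      ∀ i : SimpleGraph.completeGraph (Fin 2) →g T, Function.Injective i →
        IsHomotopyEquivalence (homComplexMap i (SimpleGraph.completeGraph (Fin n)))) ∧
    (∀ (V : Type*) [Finite V] (F : SimpleGraph V), F.IsAcyclic →
      Nonempty (ContinuousMap.HomotopyEquiv
        (HomComplex Fᶜ (SimpleGraph.completeGraph (Fin n)))
        (HomComplex (SimpleGraph.completeGraph (Fin F.indepNum))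
          (SimpleGraph.completeGraph (Fin n))))) :=
  ⟨fun _ _ T hT _ i hi => SimpleGraph.IsTree.isHomotopyEquivalence_homComplexMap _ T hT i hi,
    fun _ _ F hF => SimpleGraph.IsAcyclic.nonempty_homotopyEquiv_compl _ F hF⟩
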